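/- A Dyck path of size $n\ge 0$ is a word $P$ with $n$ letters $u$ (up steps $(1,1)$) and $n$ letters $d$ (down steps $(1,-1)$) whose walk from the origin stays weakly above the $x$-axis; a contact of $P$ is a point of this walk on the $x$-axis. If $P=V\,d\,P_1\,W$ as a word, where $P_1$ is a non-empty Dyck path that returns to the $x$-axis only at its end, then $P'=V\,P_1\,d\,W$ is said to be obtained from $P$ by a right rotation. The Tamari order on Dyck paths of size $n$ is the order $P\preceq Q$ if and only if $Q$ is obtained from $P$ by a (possibly empty) sequence of right rotations. A Tamari interval $I=[P,Q]$ of size $n$ is a pair of Dyck paths of size $n$ with $P\preceq Q$. The contact vector $(c_0(I),\dots,c_n(I))$ of $I=[P,Q]$ is that of $P$: $c_0(I)$ is the number of non-initial contacts of $P$ and, for $1\le i\le n$, $c_i(I)$ is the number of non-initial contacts of the (longest) Dyck path that follows the $i$-th up step of $P$. The descent vector $(d_0(I),\dots,d_n(I))$ of $I$ is that of $Q$: it is defined by $Q=d^{\,d_n(I)}\,u\,d^{\,d_{n-1}(I)}\,u\cdots u\,d^{\,d_0(I)}$. The Tamari distance $\mathrm{L}(I)$ is the largest $k\ge 0$ for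 which there is a strictly increasing chain $P=D_0\prec D_1\prec\cdots\prec D_k=Q$ of Dyck paths of size $n$. **Theorem.** For every Tamari interval $I$ of size $n\ge 0$, $$\mathrm{L}(I)=\sum_{0\le i<j\le n}\bigl(c_i(I)-1\bigr)\bigl(1-d_{n-j}(I)\bigr).$$ -/

import Mathlib

namespace TamariFormula

/-- Dyck paths of size `n`: Dyck words with `n` up steps and `n` down steps.  (A structure, so that
it does not inherit the unrelated nesting order which Mathlib puts on `DyckWord`.) -/
@[ext]
structure DyckPath (n : ℕ) where
  word : DyckWord
  size_eq : word.semilength = n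

/-- `P'` is obtained from `P` by a right rotation: `P = V d P₁ W` and `P' = V P₁ d W` as words,
where `P₁` is a non-empty Dyck path that returns to the axis only at its end
(`DyckWord.IsNested`). -/
def RightRotation {n : ℕ} (P P' : DyckPath n) : Prop :=
  ∃ (V W : List DyckStep) (P₁ : DyckWord), P₁.IsNested ∧
    P.word.toList = V ++ [DyckStep.D] ++ P₁.toList ++ W ∧
    P'.word.toList = V ++ P₁.toList ++ [DyckStep.D] ++ W

/-- The number of pairs (up step, later down step) of a word; only used to see that the Tamari
relation is antisymmetric and that its chains are bounded. -/
def upDownPairs : List DyckStep → ℕ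
  | [] => 0
  | DyckStep.U :: l => l.count DyckStep.D + upDownPairs l
  | DyckStep.D :: l => upDownPairs l

theorem upDownPairs_append (a b : List DyckStep) :
    upDownPairs (a ++ b) =
      upDownPairs a + upDownPairs b + a.count DyckStep.U * b.count DyckStep.D := by
  induction a with
  | nil => simp [upDownPairs]
  | cons s a ih =>
    cases s
    · simp [upDownPairs, ih, add_mul]; ring
    · simp [upDownPairs, ih]

theorem RightRotation.upDownPairs_lt {n : ℕ} {P P' : DyckPath n} (h : RightRotation P P') :
    upDownPairs P.word.toList < upDownPairs P'.word.toList := by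
  obtain ⟨V, W, P₁, hP₁, hP, hP'⟩ := h
  have hpos : 0 < P₁.toList.count DyckStep.U := by
    have hne := hP₁.1
    rw [List.count_pos_iff]
    rw [← DyckWord.head_eq_U P₁ (DyckWord.toList_ne_nil.mpr hne)]
    exact List.head_mem _
  rw [hP, hP']
  simp only [upDownPairs_append, List.count_append]
  simp [upDownPairs]
  nlinarith

theorem upDownPairs_le_of_reflTransGen {n : ℕ} {P Q : DyckPath n}
    (h : Relation.ReflTransGen RightRotation P Q) :
    P = Q ∨ upDownPairs P.word.toList < upDownPairs Q.word.toList := by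
  induction h with
  | refl => exact Or.inl rfl
  | tail _ h2 ih =>
    right
    rcases ih with rfl | ih
    · exact h2.upDownPairs_lt
    · exact ih.trans h2.upDownPairs_lt

/-- The Tamari order on Dyck paths of size `n`: `P ≤ Q` if `Q` is obtained from `P` by a (possibly
empty) sequence of right rotations. -/
instance (n : ℕ) : PartialOrder (DyckPath n) where
  le := Relation.ReflTransGen RightRotation
  le_refl _ := Relation.ReflTransGen.refl
  le_trans _ _ _ h₁ h₂ := Relation.ReflTransGen.trans h₁ h₂
  le_antisymm P Q h₁ h₂ := by
    rcases upDownPairs_le_of_reflTransGen h₁ with h | h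
    · exact h
    · rcases upDownPairs_le_of_reflTransGen h₂ with h' | h'
      · exact h'.symm
      · exact absurd h' (lt_asymm h)

/-- The part of a word after its `i`-th up step (the whole word for `i = 0`). -/
def afterUp : ℕ → List DyckStep → List DyckStep
  | 0, l => l
  | _ + 1, [] => []
  | i + 1, DyckStep.U :: l => afterUp i l
  | i + 1, DyckStep.D :: l => afterUp (i + 1) l

/-- The number of non-initial contacts of the Dyck path with which the word `l` starts, that is, of
the longest prefix of `l` that is a Dyck path: the number of `k ≥ 1` such that the walk `l` is at
height `0` after `k` steps and has not been at a negative height before. -/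
def nonInitialContacts (l : List DyckStep) : ℕ :=
  ((Finset.Icc 1 l.length).filter fun k =>
    (l.take k).count DyckStep.U = (l.take k).count DyckStep.D ∧
    ∀ m ≤ k, (l.take m).count DyckStep.D ≤ (l.take m).count DyckStep.U).card

/-- The contact vector `(c₀(P), …, cₙ(P))`. -/
def DyckPath.contactVector {n : ℕ} (P : DyckPath n) (i : Fin (n + 1)) : ℕ :=
  nonInitialContacts (afterUp i P.word.toList)

/-- The descent vector `(d₀(P), …, dₙ(P))`, determined by `P = d^{dₙ} u d^{dₙ₋₁} u … u d^{d₀}`: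
`dᵢ(P)` is the number of down steps that directly follow the `(n - i)`-th up step (that start `P`
if `i = n`). -/
def DyckPath.descentVector {n : ℕ} (P : DyckPath n) (i : Fin (n + 1)) : ℕ :=
  ((afterUp (n - i) P.word.toList).takeWhile (· = DyckStep.D)).length

/-- A Tamari interval `[P, Q]` of size `n`: Dyck paths `P ≤ Q` of size `n`. -/
structure TamariInterval (n : ℕ) where
  lower : DyckPath n
  upper : DyckPath n
  le : lower ≤ upper

namespace TamariInterval

variable {n : ℕ}

/-- The contact vector of an interval is that of its lower path. -/
def contactVector (I : TamariInterval n) : Fin (n + 1) → ℕ := I.lower.contactVector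

/-- The descent vector of an interval is that of its upper path. -/
def descentVector (I : TamariInterval n) : Fin (n + 1) → ℕ := I.upper.descentVector

/-- The lengths `k` of the strictly increasing chains `P = D₀ < D₁ < … < Dₖ = Q` from the lower to
the upper path (the length of an `LTSeries` is its number of steps). -/
def chainLengths (I : TamariInterval n) : Set ℕ :=
  {k | ∃ s : LTSeries (DyckPath n), s.head = I.lower ∧ s.last = I.upper ∧ s.length = k}

/-- The Tamari distance: the length of the longest strictly increasing chain from the lower to the
upper path. -/
noncomputable def distance (I : TamariInterval n) : ℕ := sSup I.chainLengths

theorem upDownPairs_strictMono :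
    StrictMono fun P : DyckPath n => upDownPairs P.word.toList := by
  intro P Q h
  rcases upDownPairs_le_of_reflTransGen h.le with h' | h'
  · exact absurd h' h.ne
  · exact h'

/-- The longest chain exists, so that the supremum above is a maximum. -/
theorem isGreatest_distance (I : TamariInterval n) : IsGreatest I.chainLengths I.distance := by
  have hne : I.chainLengths.Nonempty := by
    rcases I.le.eq_or_lt with h | h
    · exact ⟨0, RelSeries.singleton _ I.lower, rfl, h, rfl⟩
    · exact ⟨1, RelSeries.cons (RelSeries.singleton _ I.upper) I.lower h, RelSeries.head_cons .., RelSeries.last_cons .., rfl⟩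
  have hbdd : BddAbove I.chainLengths := by
    refine ⟨upDownPairs I.upper.word.toList, ?_⟩
    rintro k ⟨s, -, hl, rfl⟩
    have := (s.map _ upDownPairs_strictMono).head_add_length_le_nat
    have h2 : (s.map _ upDownPairs_strictMono).last = upDownPairs s.last.word.toList := rfl
    have h3 : (s.map _ upDownPairs_strictMono).length = s.length := rfl
    rw [h2, h3, hl] at this
    omega
  exact ⟨Nat.sSup_mem hne hbdd, fun _ hk => le_csSup hbdd hk⟩

end TamariInterval

end TamariFormula

/-!
A Dyck path is encoded by its valley sequence `f`: `f m` is the height just before the `(m + 1)`-st up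
step.  An index `q < k` is visible from `k` if `f` stays above `f q` on `(q, k]` (`Visible`), and
`parent f k` is one more than the last visible index, or `0` if there is none.  The contact number
`cᵢ(P)` counts the indices `k < n` with parent `i` (`DyckPath.contactVector_eq`), while `1 - d_{n-j}(Q)`
is the increment `g j - g (j - 1)` of the valley sequence `g` of `Q`.  Hence the sum of the theorem
telescopes to `gap n f g = ∑ k < n, (g k - g (parent f k))`
(`sum_contactVector_mul_descentVector`).  As `f (parent f k) = f k`, this vanishes for `f = g`.

A right rotation adds one to `f` on an excursion `[m, m')` above `f m` (`IsLift`).  It preserves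
visibility, so that `P ≤ Q` implies `Below f g`: what is visible in `f` is visible in `g`.  When `f`
grows below `g`, every parent moves later, and the height of the parent in `g` strictly increases if
it moves at all (`Below.apply_parent_lt`).  As the parents determine `f`, the gap to `g` drops by at
least one at each step of a chain, which bounds the length of the chain (`gap_lt`, `length_le_gap`).

Conversely, if `Below f g` and `f ≠ g`, let `p` be the first index that has more visibility in `g`
than in `f`, and rotate `f` at the first `m > p` with `f m ≤ f p`.  By the minimality of `p`, the
result is still below `g`, only the parent of `m` changes, and its height in `g` increases by exactly
one (`exists_rotation_index`, `IsLift.below_of_visible`, `IsLift.gap_eq`).  Iterating gives a chain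
whose length is the gap.
-/

namespace TamariFormula

open DyckStep

/-! ### Heights along a word -/

/-- The height at which a walk from the origin with steps `l` ends. -/
def height (l : List DyckStep) : ℤ := l.count U - l.count D

/-- The valley sequence of a word: `valley l m` is the height of the walk `l` just before its
`(m + 1)`-st up step, and the final height if there are at most `m` up steps. -/
def valley : List DyckStep → ℕ → ℤ
  | [], _ => 0
  | U :: _, 0 => 0
  | U :: l, m + 1 => 1 + valley l m
  | D :: l, m => -1 + valley l m

@[simp] theorem height_nil : height [] = 0 := by simp [height]

@[simp] theorem height_U_cons (l : List DyckStep) : height (U :: l) = 1 + height l := by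
  simp [height]; ring

@[simp] theorem height_D_cons (l : List DyckStep) : height (D :: l) = -1 + height l := by
  simp [height]; ring

@[simp] theorem height_append (a b : List DyckStep) : height (a ++ b) = height a + height b := by
  simp [height]; ring

theorem height_dyckWord (P : DyckWord) : height P.toList = 0 := by
  simp [height, P.count_U_eq_count_D]

theorem valley_zero_le (l : List DyckStep) : valley l 0 ≤ 0 := by
  induction l with
  | nil => simp [valley]
  | cons s l ih => cases s <;> simp [valley]; omega

theorem valley_succ_le (l : List DyckStep) (m : ℕ) : valley l (m + 1) ≤ valley l m + 1 := by
  induction l generalizing m with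
  | nil => simp [valley]
  | cons s l ih =>
    cases s
    · cases m with
      | zero => simpa [valley] using valley_zero_le l
      | succ m =>
        have := ih m
        simp only [valley]
        omega
    · have := ih m
      simp only [valley]
      omega

theorem valley_of_count_le {l : List DyckStep} {m : ℕ} (h : l.count U ≤ m) :
    valley l m = height l := by
  induction l generalizing m with
  | nil => simp [valley]
  | cons s l ih =>
    cases s
    · cases m with
      | zero => simp at h
      | succ m => simp [valley, ih (m := m) (by simpa using h)]
    · simp [valley, ih (m := m) (by simpa using h)]

theorem valley_append_of_lt {a : List DyckStep} (b : List DyckStep) {m : ℕ}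
    (h : m < a.count U) : valley (a ++ b) m = valley a m := by
  induction a generalizing m with
  | nil => simp at h
  | cons s a ih =>
    cases s
    · cases m with
      | zero => simp [valley]
      | succ m => simp [valley, ih (m := m) (by simpa using h)]
    · simp [valley, ih (m := m) (by simpa using h)]

theorem valley_append_add (a b : List DyckStep) (k : ℕ) :
    valley (a ++ b) (a.count U + k) = height a + valley b k := by
  induction a with
  | nil => simp
  | cons s a ih =>
    cases s
    · simp [valley, add_right_comm _ 1 k, ih, add_assoc]
    · simp [valley, ih, add_assoc]

theorem exists_valley_eq_height_take {l : List DyckStep} {m : ℕ} (h : m < l.count U) :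
    ∃ i, m ≤ i ∧ i < l.length ∧ valley l m = height (l.take i) := by
  induction l generalizing m with
  | nil => simp at h
  | cons s l ih =>
    cases s
    · cases m with
      | zero => exact ⟨0, by simp [valley]⟩
      | succ m =>
        obtain ⟨i, h1, h2, h3⟩ := ih (m := m) (by simpa using h)
        exact ⟨i + 1, by omega, by simpa using h2, by simp [valley, h3]⟩
    · obtain ⟨i, h1, h2, h3⟩ := ih (m := m) (by simpa using h)
      exact ⟨i + 1, by omega, by simpa using h2, by simp [valley, h3]⟩

/-- The minimum of a walk is attained just before an up step or at the end. -/
theorem valley_le_height_take (l : List DyckStep) (i : ℕ) :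
    valley l ((l.take i).count U) ≤ height (l.take i) := by
  induction l generalizing i with
  | nil => simp [valley]
  | cons s l ih =>
    cases i with
    | zero => simpa using valley_zero_le _
    | succ i => cases s <;> simpa [valley] using ih i

theorem eq_of_valley_eq {l l' : List DyckStep} (hc : l.count U = l'.count U)
    (h : ∀ m, valley l m = valley l' m) : l = l' := by
  induction l generalizing l' with
  | nil =>
    cases l' with
    | nil => rfl
    | cons s l' =>
      cases s
      · simp at hc
      · have := h 0
        have := valley_zero_le l'
        simp [valley] at *; omega
  | cons s l ih =>
    cases l' with
    | nil =>
      cases s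
      · simp at hc
      · have := h 0
        have := valley_zero_le l
        simp [valley] at *; omega
    | cons s' l' =>
      cases s <;> cases s'
      · rw [ih (by simpa using hc) fun m => by simpa [valley] using h (m + 1)]
      · have := h 0
        have := valley_zero_le l'
        simp [valley] at *; omega
      · have := h 0
        have := valley_zero_le l
        simp [valley] at *; omega
      · rw [ih (by simpa using hc) fun m => by simpa [valley] using h m]

/-- After the `(i + 1)`-st up step, which starts at height `valley l i`, the valleys of `l` are those
of the remaining word. -/
theorem valley_succ_add (l : List DyckStep) {i : ℕ} (hi : i < l.count U) (k : ℕ) :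
    valley l (i + 1 + k) = valley l i + 1 + valley (afterUp (i + 1) l) k := by
  induction l generalizing i with
  | nil => simp at hi
  | cons s l ih =>
    cases s
    · cases i with
      | zero => simp [valley, afterUp, add_comm 1 k]
      | succ i =>
        have := ih (i := i) (by simpa using hi)
        rw [show i + 1 + 1 + k = (i + 1 + k) + 1 by ring]
        simp only [valley, afterUp, this]
        ring
    · have := ih (i := i) (by simpa using hi)
      simp only [valley, afterUp, this]
      ring

theorem count_U_afterUp (l : List DyckStep) {i : ℕ} (hi : i ≤ l.count U) :
    (afterUp i l).count U + i = l.count U := by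
  induction l generalizing i with
  | nil => cases i <;> simp_all [afterUp]
  | cons s l ih =>
    cases i with
    | zero => simp [afterUp]
    | succ i =>
      cases s
      · have := ih (i := i) (by simpa using hi)
        simp [afterUp]; omega
      · have := ih (i := i + 1) (by simpa using hi)
        simp [afterUp]; omega

theorem valley_zero_eq_neg_length (l : List DyckStep) :
    valley l 0 = -((l.takeWhile (· = D)).length : ℤ) := by
  induction l with
  | nil => simp [valley]
  | cons s l ih =>
    cases s
    · simp [valley]
    · simp [valley, ih]

/-! ### Counting contacts by the up steps that start at them -/

/-- The condition that a walk with heights `h 0, h 1, …` is at height `0` at time `k`, without having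
been negative before. -/
def IsContact (h : ℕ → ℤ) (k : ℕ) : Prop := h k = 0 ∧ ∀ m ≤ k, 0 ≤ h m

theorem isContact_zero {h : ℕ → ℤ} : IsContact h 0 ↔ h 0 = 0 := by
  constructor
  · exact fun H => H.1
  · exact fun H => ⟨H, fun m hm => by simp_all⟩

theorem isContact_succ {h : ℕ → ℤ} {k : ℕ} :
    IsContact h (k + 1) ↔ 0 ≤ h 0 ∧ IsContact (fun m => h (m + 1)) k := by
  constructor
  · exact fun H => ⟨H.2 0 (by omega), H.1, fun m hm => H.2 (m + 1) (by omega)⟩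
  · rintro ⟨h0, h1, h2⟩
    refine ⟨h1, fun m hm => ?_⟩
    cases m with
    | zero => exact h0
    | succ m => exact h2 m (by omega)

open Classical in
/-- The number of contacts among the first `N` terms of a sequence of heights. -/
noncomputable def numContacts (h : ℕ → ℤ) (N : ℕ) : ℕ :=
  ∑ k ∈ Finset.range N, if IsContact h k then 1 else 0

theorem numContacts_succ {h : ℕ → ℤ} (h0 : 0 ≤ h 0) (N : ℕ) :
    numContacts h (N + 1) =
      numContacts (fun m => h (m + 1)) N + if h 0 = 0 then 1 else 0 := by
  classical
  simp only [numContacts, Finset.sum_range_succ', isContact_zero]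
  congr 1
  exact Finset.sum_congr rfl fun k _ => if_congr (isContact_succ.trans (and_iff_right h0)) rfl rfl

theorem numContacts_eq_zero {h : ℕ → ℤ} (h0 : h 0 < 0) (N : ℕ) : numContacts h N = 0 := by
  simp only [numContacts, Finset.sum_eq_zero_iff, Finset.mem_range]
  intro k _
  rw [if_neg]
  intro H
  have := H.2 0 (by omega)
  omega

/-- In a walk that starts at height `h ≥ 0` and ends at or below the axis, every contact but the last
one is the starting point of an up step. -/
theorem numContacts_take (l : List DyckStep) {h : ℤ} (h0 : 0 ≤ h) (hl : h + height l ≤ 0) :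
    numContacts (fun k => h + height (l.take k)) (l.length + 1) =
      numContacts (fun m => h + valley l m) (l.count U) + 1 := by
  induction l generalizing h with
  | nil =>
    have : h = 0 := by simp at hl; omega
    subst this
    have h1 : IsContact (fun k => (0 : ℤ) + height (List.take k [])) 0 := by
      simp [isContact_zero]
    rw [List.length_nil, zero_add, numContacts, Finset.sum_range_one, if_pos h1]
    simp [numContacts]
  | cons s l ih =>
    rw [List.length_cons, numContacts_succ (by simpa using h0)]
    cases s
    · have := ih (h := h + 1) (by omega) (by simp at hl; omega)
      simp only [add_assoc] at this
      simp only [List.count_cons_self, numContacts_succ (h := fun m => h + valley (U :: l) m)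
        (by simpa [valley] using h0)]
      simp [valley, this]
      omega
    · rcases h0.eq_or_lt with rfl | h1
      · have := valley_zero_le l
        rw [numContacts_eq_zero (by simp), numContacts_eq_zero (by simp [valley]; omega)]
        simp
      · have := ih (h := h - 1) (by omega) (by simp at hl; omega)
        simp only [sub_eq_add_neg, add_assoc] at this
        simp [valley, this]
        omega

theorem nonInitialContacts_eq {l : List DyckStep} (hl : height l ≤ 0) :
    nonInitialContacts l = numContacts (valley l) (l.count U) := by
  classical
  have key := numContacts_take l le_rfl (by simpa using hl)
  simp only [zero_add] at key
  have : nonInitialContacts l + 1 = numContacts (fun k => height (l.take k)) (l.length + 1) := by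
    rw [numContacts, Finset.sum_range_succ', if_pos (isContact_zero.2 (by simp))]
    congr 1
    rw [nonInitialContacts, Finset.card_filter, Finset.range_eq_Ico,
      Finset.sum_Ico_add' (fun k => if IsContact (fun k => height (l.take k)) k then 1 else 0)]
    refine Finset.sum_congr (by ext; simp) fun k _ => ?_
    congr 1
    simp only [IsContact, height, sub_eq_zero, sub_nonneg, Nat.cast_inj, Nat.cast_le]
  rw [key] at this
  exact Nat.succ_injective this

/-! ### Valley sequences of Dyck paths -/

/-- The properties of the valley sequence of a Dyck path of size `n`. -/
structure IsDyckSeq (n : ℕ) (f : ℕ → ℤ) : Prop where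
  zero : f 0 = 0
  succ_le : ∀ m, f (m + 1) ≤ f m + 1
  nonneg : ∀ m, 0 ≤ f m
  eq_zero : ∀ m, n ≤ m → f m = 0

/-- The valley sequence of a Dyck path. -/
def DyckPath.valley {n : ℕ} (P : DyckPath n) : ℕ → ℤ := TamariFormula.valley P.word.toList

theorem DyckPath.count_U {n : ℕ} (P : DyckPath n) : P.word.toList.count U = n := P.size_eq

theorem DyckPath.isDyckSeq {n : ℕ} (P : DyckPath n) : IsDyckSeq n P.valley := by
  have h0 : ∀ m, n ≤ m → P.valley m = 0 := fun m hm => by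
    rw [DyckPath.valley, valley_of_count_le (P.count_U.trans_le hm), height_dyckWord]
  have h1 : ∀ m, 0 ≤ P.valley m := fun m => by
    by_cases hm : n ≤ m
    · exact (h0 m hm).ge
    · obtain ⟨i, -, -, h⟩ := exists_valley_eq_height_take (l := P.word.toList) (m := m)
        (by rw [P.count_U]; omega)
      have := P.word.count_D_le_count_U i
      rw [DyckPath.valley, h, height]
      omega
  exact ⟨le_antisymm (valley_zero_le _) (h1 0), valley_succ_le _, h1, h0⟩

theorem DyckPath.valley_injective {n : ℕ} :
    Function.Injective (DyckPath.valley : DyckPath n → ℕ → ℤ) := fun P Q h =>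
  DyckPath.ext (DyckWord.ext (eq_of_valley_eq (P.count_U.trans Q.count_U.symm) (congrFun h)))

/-! ### Parents and visibility in a valley sequence -/

/-- `Visible f p m`: the sequence `f` stays above `f p` on `(p, m]`.  For a valley sequence this says
that the `(p + 1)`-st up step is not yet closed after the down steps following the `m`-th one. -/
def Visible (f : ℕ → ℤ) (p m : ℕ) : Prop := ∀ j, p < j → j ≤ m → f p < f j

theorem Visible.mono {f : ℕ → ℤ} {p m k : ℕ} (h : Visible f p m) (hk : k ≤ m) : Visible f p k :=
  fun j h1 h2 => h j h1 (h2.trans hk)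

theorem Visible.trans {f : ℕ → ℤ} {p m k : ℕ} (hpm : p < m) (h : Visible f p m)
    (h' : Visible f m k) : Visible f p k := fun j h1 h2 => by
  rcases le_or_gt j m with hj | hj
  · exact h j h1 hj
  · exact (h m hpm le_rfl).trans (h' j hj h2)

/-- For a valley sequence `f`, the number `i` of the up step whose top is the point from which the
component containing the `(k + 1)`-st up step hangs: `i - 1` is the last index before `k` with a
smaller value, and `i = 0` if there is none. -/
def parent (f : ℕ → ℤ) (k : ℕ) : ℕ := Nat.findGreatest (fun i => f (i - 1) < f k) k

theorem parent_eq_iff {f : ℕ → ℤ} {k i : ℕ} :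
    parent f k = i ↔ i ≤ k ∧ (i ≠ 0 → f (i - 1) < f k) ∧ ∀ j, i ≤ j → j < k → f k ≤ f j := by
  rw [parent, Nat.findGreatest_eq_iff]
  refine and_congr_right fun _ => and_congr_right fun _ => ⟨fun h j h1 h2 => ?_, fun h j h1 h2 => ?_⟩
  · simpa using h (n := j + 1) (by omega) (by omega)
  · simpa using h (j - 1) (by omega) (by omega)

theorem parent_le (f : ℕ → ℤ) (k : ℕ) : parent f k ≤ k := (parent_eq_iff.1 rfl).1

theorem le_of_parent_le {f : ℕ → ℤ} {k j : ℕ} (h : parent f k ≤ j) (hj : j ≤ k) : f k ≤ f j := by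
  rcases hj.eq_or_lt with rfl | hj
  · exact le_rfl
  · exact (parent_eq_iff.1 rfl).2.2 j h hj

theorem visible_parent {f : ℕ → ℤ} {k : ℕ} (h : parent f k ≠ 0) :
    Visible f (parent f k - 1) k := fun j h1 h2 =>
  ((parent_eq_iff.1 rfl).2.1 h).trans_le (le_of_parent_le (by omega) h2)

theorem le_parent {f : ℕ → ℤ} {q k : ℕ} (hq : q < k) (h : Visible f q k) : q + 1 ≤ parent f k := by
  by_contra! hlt
  have := le_of_parent_le (f := f) (k := k) (j := q) (by omega) hq.le
  have := h k hq le_rfl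
  omega

/-- Since up steps have height one, an index has the same value as its parent. -/
theorem apply_parent {n : ℕ} {f : ℕ → ℤ} (hf : IsDyckSeq n f) (k : ℕ) : f (parent f k) = f k := by
  have h1 := le_of_parent_le le_rfl (parent_le f k)
  by_cases h : parent f k = 0
  · have := hf.nonneg k
    rw [h, hf.zero] at h1 ⊢
    omega
  · have h2 := (parent_eq_iff.1 (rfl : parent f k = _)).2.1 h
    have h3 := hf.succ_le (parent f k - 1)
    rw [show parent f k - 1 + 1 = parent f k by omega] at h3
    omega

/-- A valley sequence is determined by its parent function: its value is the depth of the index. -/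
theorem eq_of_parent_eq {n : ℕ} {f g : ℕ → ℤ} (hf : IsDyckSeq n f) (hg : IsDyckSeq n g)
    (h : ∀ k < n, parent f k = parent g k) : f = g := by
  have step {f : ℕ → ℤ} (hf : IsDyckSeq n f) (k : ℕ) (h0 : parent f k ≠ 0) :
      f k = f (parent f k - 1) + 1 := by
    have h1 := apply_parent hf k
    have h2 := (parent_eq_iff.1 (rfl : parent f k = _)).2.1 h0
    have h3 := hf.succ_le (parent f k - 1)
    rw [show parent f k - 1 + 1 = parent f k by omega] at h3
    omega
  funext k
  induction k using Nat.strong_induction_on with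
  | _ k ih =>
    rcases le_or_gt n k with hk | hk
    · rw [hf.eq_zero k hk, hg.eq_zero k hk]
    by_cases h0 : parent f k = 0
    · rw [← apply_parent hf, ← apply_parent hg, ← h k hk, h0, hf.zero, hg.zero]
    · have := parent_le f k
      rw [step hf k h0, step hg k (h k hk ▸ h0), ← h k hk, ih _ (by omega)]

/-! ### The distance function on valley sequences -/

/-- The order on valley sequences that corresponds to the Tamari order. -/
def Below (f g : ℕ → ℤ) : Prop := ∀ p m, Visible f p m → Visible g p m

theorem Below.parent_le_parent {f g : ℕ → ℤ} (h : Below f g) (k : ℕ) :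
    parent f k ≤ parent g k := by
  by_cases h0 : parent f k = 0
  · omega
  · have := parent_le f k
    have := le_parent (f := g) (q := parent f k - 1) (k := k) (by omega) (h _ _ (visible_parent h0))
    omega

/-- If `f` and `f'` both lie below `g`, and the parent of `k` is later in `f'` than in `f`, then it is
also higher in `g`, since both parents are ancestors of `k` in `g`. -/
theorem Below.apply_parent_lt {n : ℕ} {f f' g : ℕ → ℤ} (hg : IsDyckSeq n g) (hfg : Below f g)
    (hfg' : Below f' g) {k : ℕ} (h : parent f k < parent f' k) :
    g (parent f k) < g (parent f' k) := by
  have hk := parent_le f' k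
  have h1 := hfg' _ _ (visible_parent (f := f') (k := k) (by omega)) (parent f' k) (by omega) hk
  refine lt_of_le_of_lt ?_ h1
  by_cases h0 : parent f k = 0
  · rw [h0, hg.zero]
    exact hg.nonneg _
  · have h2 := hfg _ _ (visible_parent h0) (parent f' k - 1) (by omega) (by omega)
    have h3 := hg.succ_le (parent f k - 1)
    rw [show parent f k - 1 + 1 = parent f k by omega] at h3
    omega

/-- The distance from `f` to `g`, as a function of the parents in `f` and the heights in `g`. -/
def gap (n : ℕ) (f g : ℕ → ℤ) : ℤ := ∑ k ∈ Finset.range n, (g k - g (parent f k))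

theorem gap_self {n : ℕ} {f : ℕ → ℤ} (hf : IsDyckSeq n f) : gap n f f = 0 :=
  Finset.sum_eq_zero fun k _ => by rw [apply_parent hf, sub_self]

/-- Moving up below `g` strictly decreases the gap to `g`. -/
theorem gap_lt {n : ℕ} {f f' g : ℕ → ℤ} (hf : IsDyckSeq n f) (hf' : IsDyckSeq n f')
    (hg : IsDyckSeq n g) (h : Below f f') (h' : Below f' g) (hne : f ≠ f') :
    gap n f' g < gap n f g := by
  have hfg : Below f g := fun p m H => h' p m (h p m H)
  have hle (k : ℕ) : parent f k = parent f' k ∨ g (parent f k) < g (parent f' k) :=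
    (h.parent_le_parent k).eq_or_lt.imp id fun H => hfg.apply_parent_lt hg h' H
  refine Finset.sum_lt_sum (fun k _ => ?_) ?_
  · rcases hle k with H | H
    · rw [H]
    · omega
  · by_contra! hc
    refine hne (eq_of_parent_eq hf hf' fun k hk => (hle k).resolve_right fun H => ?_)
    have := hc k (by simpa using hk)
    omega

theorem gap_nonneg {n : ℕ} {f g : ℕ → ℤ} (hf : IsDyckSeq n f) (hg : IsDyckSeq n g)
    (h : Below f g) : 0 ≤ gap n f g := by
  by_cases hne : f = g
  · rw [hne, gap_self hg]
  · have := gap_lt hf hg hg h (fun _ _ H => H) hne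
    rw [gap_self hg] at this
    omega

/-! ### Rotations of valley sequences -/

/-- The effect of a right rotation on the valley sequence: `f'` is `f + 1` on the excursion `[m, m')`
of `f` above `f m`, and `f` elsewhere. -/
structure IsLift (f f' : ℕ → ℤ) (m m' : ℕ) : Prop where
  lt : m < m'
  apply_eq : ∀ k, f' k = f k + if m ≤ k ∧ k < m' then 1 else 0
  above : ∀ k, m < k → k < m' → f m < f k
  apply_le : f m' ≤ f m

namespace IsLift

variable {f f' : ℕ → ℤ} {m m' : ℕ}

theorem le (h : IsLift f f' m m') {k : ℕ} (h1 : m ≤ k) (h2 : k < m') : f m ≤ f k := by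
  rcases h1.eq_or_lt with rfl | h1
  · exact le_rfl
  · exact (h.above k h1 h2).le

theorem apply_mem (h : IsLift f f' m m') {k : ℕ} (h1 : m ≤ k) (h2 : k < m') : f' k = f k + 1 := by
  rw [h.apply_eq, if_pos ⟨h1, h2⟩]

theorem apply_not_mem (h : IsLift f f' m m') {k : ℕ} (hk : k < m ∨ m' ≤ k) : f' k = f k := by
  rw [h.apply_eq, if_neg (by omega), add_zero]

theorem le_apply (h : IsLift f f' m m') (k : ℕ) : f k ≤ f' k := by
  rw [h.apply_eq]; split_ifs <;> omega

theorem below (h : IsLift f f' m m') : Below f f' := by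
  intro q k H j h1 h2
  have := H j h1 h2
  by_cases hq : m ≤ q ∧ q < m'
  · have hk : k < m' := by
      by_contra! hk
      have := H m' hq.2 hk
      have := h.le hq.1 hq.2
      have := h.apply_le
      omega
    rw [h.apply_mem hq.1 hq.2, h.apply_mem (by omega) (by omega)]
    omega
  · rw [h.apply_not_mem (by omega)]
    have := h.le_apply j
    omega

/-- A rotation at `m` only changes the parent of `m`. -/
theorem parent_eq (h : IsLift f f' m m') {k : ℕ} (hk : k ≠ m) : parent f' k = parent f k := by
  obtain ⟨h1, h2, h3⟩ := (parent_eq_iff (f := f) (k := k)).1 rfl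
  refine parent_eq_iff.2 ⟨h1, fun h0 => ?_, fun j hj hjk => ?_⟩
  · specialize h2 h0
    by_cases hq : m ≤ parent f k - 1 ∧ parent f k - 1 < m'
    · have hkm : k < m' := by
        by_contra! hkm
        have := le_of_parent_le (f := f) (k := k) (j := m') (by omega) hkm
        have := h.le hq.1 hq.2
        have := h.apply_le
        omega
      rw [h.apply_mem hq.1 hq.2, h.apply_mem (by omega) hkm]
      omega
    · rw [h.apply_not_mem (by omega)]
      have := h.le_apply k
      omega
  · specialize h3 j hj hjk
    by_cases hkm : m ≤ k ∧ k < m'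
    · rw [h.apply_mem hkm.1 hkm.2]
      by_cases hjm : m ≤ j
      · rw [h.apply_mem hjm (by omega)]
        omega
      · -- here `j < m < k < m'`, but `m` is visible from `k`, so that `m < parent f k ≤ j`
        have := h.above k (by omega) hkm.2
        have := le_of_parent_le (f := f) (k := k) (j := m) (by omega) hkm.1
        omega
    · rw [h.apply_not_mem (by omega)]
      have := h.le_apply j
      omega

end IsLift

/-- If `f ≠ g` lies below `g`, the first `p` whose visibility differs in `f` and `g` gives a valley `m` of `f` at
which a rotation is possible that moves `f` towards `g` as slowly as possible. -/
theorem exists_rotation_index {n : ℕ} {f g : ℕ → ℤ} (hf : IsDyckSeq n f) (hg : IsDyckSeq n g)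
    (h : Below f g) (hne : f ≠ g) :
    ∃ p m, p < m ∧ m < n ∧ f m = f p ∧ Visible f p (m - 1) ∧ Visible g p m ∧
      ∀ q < p, ∀ k, Visible g q k → Visible f q k := by
  classical
  have hex : ∃ p m, Visible g p m ∧ ¬Visible f p m := by
    by_contra! hc
    exact hne (eq_of_parent_eq hf hg fun k _ => le_antisymm (h.parent_le_parent k)
      (Below.parent_le_parent hc k))
  obtain ⟨p, ⟨m₀, hm₀, hm₀'⟩, hmin⟩ : ∃ p, (∃ m, Visible g p m ∧ ¬Visible f p m) ∧
      ∀ q < p, ¬∃ m, Visible g q m ∧ ¬Visible f q m :=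
    ⟨Nat.find hex, Nat.find_spec hex, fun q hq => Nat.find_min hex hq⟩
  replace hmin : ∀ q < p, ∀ k, Visible g q k → Visible f q k := fun q hq k hk => by
    by_contra hc
    exact hmin q hq ⟨k, hk, hc⟩
  have hex' : ∃ m, p < m ∧ m ≤ m₀ ∧ f m ≤ f p := by
    simpa [Visible] using hm₀'
  obtain ⟨m, ⟨hpm, hmm₀, hle⟩, hm⟩ : ∃ m, (p < m ∧ m ≤ m₀ ∧ f m ≤ f p) ∧
      ∀ j < m, ¬(p < j ∧ j ≤ m₀ ∧ f j ≤ f p) :=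
    ⟨Nat.find hex', Nat.find_spec hex', fun q hq => Nat.find_min hex' hq⟩
  have hgm := hm₀.mono hmm₀
  have hgp := hgm m hpm le_rfl
  refine ⟨p, m, hpm, ?_, le_antisymm hle ?_, fun j h1 h2 => ?_, hgm, hmin⟩
  · by_contra! hn
    have := hg.eq_zero m hn
    have := hg.nonneg p
    omega
  · -- the last index visible from `p` in `f` is visible from `m` in `g`, hence, by minimality
    -- of `p`, from `m` in `f`
    rw [← apply_parent hf p]
    by_cases h0 : parent f p = 0
    · rw [h0, hf.zero]
      exact hf.nonneg m
    · have hp := parent_le f p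
      have hv := hmin (parent f p - 1) (by omega) m
        (((h _ _ (visible_parent h0))).trans (by omega) hgm)
      have h1 := hv m (by omega) le_rfl
      have h2 := hf.succ_le (parent f p - 1)
      rw [show parent f p - 1 + 1 = parent f p by omega] at h2
      omega
  · have := hm j (by omega)
    omega

/-- The rotation at the index provided by `exists_rotation_index` stays below `g`. -/
theorem IsLift.below_of_visible {f f' g : ℕ → ℤ} {p m m' : ℕ} (hl : IsLift f f' m m')
    (h : Below f g) (hpm : p < m) (heq : f m = f p) (hvf : Visible f p (m - 1))
    (hvg : Visible g p m) : Below f' g := by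
  intro q k H
  by_cases hqk : Visible f q k
  · exact h q k hqk
  obtain ⟨j, hj1, hj2, hj3⟩ : ∃ j, q < j ∧ j ≤ k ∧ f j ≤ f q := by simpa [Visible] using hqk
  -- the lift only makes new indices visible from `p`, and these end with the lifted excursion
  have hj4 := H j hj1 hj2
  have hjm : m ≤ j ∧ j < m' := by
    by_contra hc
    rw [hl.apply_not_mem (k := j) (by omega)] at hj4
    have := hl.le_apply q
    omega
  have hqm : q < m := by
    by_contra hc
    rw [hl.apply_mem hjm.1 hjm.2, hl.apply_mem (k := q) (by omega) (by omega)] at hj4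
    omega
  rw [hl.apply_mem hjm.1 hjm.2, hl.apply_not_mem (k := q) (by omega)] at hj4
  have h1 := hl.le hjm.1 hjm.2
  have h2 := H m hqm (by omega)
  rw [hl.apply_mem le_rfl hl.lt, hl.apply_not_mem (k := q) (by omega)] at h2
  obtain rfl : q = p := by
    rcases lt_trichotomy q p with hq | hq | hq
    · have := H p hq (by omega)
      rw [hl.apply_not_mem (k := p) (by omega), hl.apply_not_mem (k := q) (by omega)] at this
      omega
    · exact hq
    · have := hvf q hq (by omega)
      omega
  have hk : k < m' := by
    by_contra! hk
    have := H m' (by omega) hk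
    rw [hl.apply_not_mem (k := m') (by omega), hl.apply_not_mem (k := q) (by omega)] at this
    have := hl.apply_le
    omega
  exact hvg.trans hpm (h m k fun i h3 h4 => hl.above i h3 (by omega))

/-- The rotation at the index provided by `exists_rotation_index` decreases the gap by one. -/
theorem IsLift.gap_eq {n : ℕ} {f f' g : ℕ → ℤ} {p m m' : ℕ}
    (hg : IsDyckSeq n g) (hl : IsLift f f' m m')
    (h : Below f g) (hpm : p < m) (hmn : m < n) (heq : f m = f p) (hvf : Visible f p (m - 1))
    (hvg : Visible g p m) (hmin : ∀ q < p, ∀ k, Visible g q k → Visible f q k) :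
    gap n f g = gap n f' g + 1 := by
  have hpar : parent f m = parent f p := by
    obtain ⟨h1, h2, h3⟩ := (parent_eq_iff (f := f) (k := p)).1 rfl
    refine parent_eq_iff.2 ⟨by omega, fun h0 => heq ▸ h2 h0, fun j hj1 hj2 => ?_⟩
    rw [heq]
    rcases le_or_gt j p with hj | hj
    · exact le_of_parent_le hj1 hj
    · exact (hvf j hj (by omega)).le
  have hpar' : parent f' m = p + 1 := by
    refine parent_eq_iff.2 ⟨hpm, fun _ => ?_, fun j hj1 hj2 => ?_⟩
    · rw [hl.apply_mem le_rfl hl.lt, hl.apply_not_mem (by omega), heq, Nat.add_sub_cancel]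
      omega
    · rw [hl.apply_mem le_rfl hl.lt, hl.apply_not_mem (by omega), heq]
      have := hvf j (by omega) (by omega)
      omega
  have hpg : parent g p = parent f p := by
    refine le_antisymm ?_ (h.parent_le_parent p)
    by_cases h0 : parent g p = 0
    · omega
    · have := parent_le g p
      have := le_parent (f := f) (q := parent g p - 1) (k := p) (by omega)
        (hmin _ (by omega) _ (visible_parent h0))
      omega
  have h1 : g (p + 1) = g p + 1 := by
    have := hvg (p + 1) (by omega) hpm
    have := hg.succ_le p
    omega
  have h2 := apply_parent hg p
  rw [hpg] at h2
  have hm : m ∈ Finset.range n := by simpa using hmn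
  rw [gap, gap, ← Finset.add_sum_erase _ _ hm, ← Finset.add_sum_erase _ _ hm, hpar, hpar', h1, h2,
    Finset.sum_congr rfl fun k hk => by rw [← hl.parent_eq (Finset.ne_of_mem_erase hk)]]
  ring

/-! ### Rotations of words -/

/-- On words, moving a down step past a balanced word `P` lifts the valleys of `P` by one. -/
theorem valley_rotation (V W : List DyckStep) (P : DyckWord) (k : ℕ) :
    valley (V ++ P.toList ++ [D] ++ W) k = valley (V ++ [D] ++ P.toList ++ W) k +
      if V.count U ≤ k ∧ k < V.count U + P.toList.count U then 1 else 0 := by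
  simp only [List.append_assoc, List.cons_append, List.nil_append]
  rcases lt_or_ge k (V.count U) with hk | hk
  · rw [valley_append_of_lt _ hk, valley_append_of_lt _ hk, if_neg (by omega), add_zero]
  obtain ⟨j, rfl⟩ := Nat.exists_eq_add_of_le hk
  rw [valley_append_add, valley_append_add]
  simp only [valley]
  rcases lt_or_ge j (P.toList.count U) with hj | hj
  · rw [valley_append_of_lt _ hj, valley_append_of_lt _ hj, if_pos (by omega)]
    ring
  obtain ⟨i, rfl⟩ := Nat.exists_eq_add_of_le hj
  rw [valley_append_add, valley_append_add, if_neg (by omega)]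
  simp only [valley, height_dyckWord]
  ring

theorem isLift_rotation (V W : List DyckStep) {P : DyckWord} (hP : P.IsNested) :
    IsLift (valley (V ++ [D] ++ P.toList ++ W)) (valley (V ++ P.toList ++ [D] ++ W))
      (V.count U) (V.count U + P.toList.count U) := by
  have hpos : 0 < P.toList.count U := by
    rw [List.count_pos_iff, ← DyckWord.head_eq_U P (DyckWord.toList_ne_nil.mpr hP.1)]
    exact List.head_mem _
  have hval (j : ℕ) : valley (V ++ [D] ++ P.toList ++ W) (V.count U + j) =
      height V + (-1 + valley (P.toList ++ W) j) := by
    simp only [List.append_assoc, List.cons_append, List.nil_append, valley_append_add, valley]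
  have hzero : valley P.toList 0 = 0 := by
    obtain ⟨i, -, -, hi⟩ := exists_valley_eq_height_take hpos
    have := P.count_D_le_count_U i
    have := valley_zero_le P.toList
    rw [height] at hi
    omega
  have hm := hval 0
  rw [add_zero, valley_append_of_lt _ hpos, hzero] at hm
  refine ⟨by omega, fun k => valley_rotation V W P k, fun k h1 h2 => ?_, ?_⟩
  · obtain ⟨j, rfl⟩ := Nat.exists_eq_add_of_lt h1
    rw [add_assoc, hm, hval, valley_append_of_lt _ (by omega)]
    obtain ⟨i, h3, h4, h5⟩ := exists_valley_eq_height_take (l := P.toList) (m := j + 1) (by omega)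
    have : (P.toList.take i).count D < (P.toList.take i).count U := hP.2 (by omega) h4
    rw [height] at h5
    omega
  · have h1 := valley_append_add P.toList W 0
    have h2 := valley_zero_le W
    rw [add_zero, height_dyckWord] at h1
    rw [hval, hm, h1]
    omega

theorem RightRotation.exists_isLift {n : ℕ} {P P' : DyckPath n} (h : RightRotation P P') :
    ∃ m m', IsLift P.valley P'.valley m m' := by
  obtain ⟨V, W, P₁, hP₁, hP, hP'⟩ := h
  refine ⟨V.count U, V.count U + P₁.toList.count U, ?_⟩
  rw [DyckPath.valley, DyckPath.valley, hP, hP']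
  exact isLift_rotation V W hP₁

theorem below_of_le {n : ℕ} {P Q : DyckPath n} (h : P ≤ Q) : Below P.valley Q.valley := by
  induction (show Relation.ReflTransGen RightRotation P Q from h) with
  | refl => exact fun _ _ H => H
  | tail h1 h2 ih =>
    obtain ⟨m, m', hl⟩ := h2.exists_isLift
    exact fun p k H => hl.below p k (ih h1 p k H)

/-- A walk that ends below the axis starts with a Dyck path followed by a down step. -/
theorem exists_dyckWord_append_of_height_neg (l : List DyckStep) (h : height l < 0) :
    ∃ (B : DyckWord) (C : List DyckStep), l = B.toList ++ D :: C := by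
  match l with
  | [] => simp at h
  | D :: l => exact ⟨0, l, rfl⟩
  | U :: l =>
    obtain ⟨B, C, rfl⟩ := exists_dyckWord_append_of_height_neg l (by simp at h; omega)
    obtain ⟨B', C', rfl⟩ := exists_dyckWord_append_of_height_neg C (by
      simp [height_dyckWord] at h; omega)
    exact ⟨B.nest + B', C', by
      rw [show (B.nest + B').toList = U :: B.toList ++ [D] ++ B'.toList from rfl]
      simp⟩
termination_by l.length

theorem exists_append_U_cons (l : List DyckStep) {m : ℕ} (h : m < l.count U) :
    ∃ A B, l = A ++ U :: B ∧ A.count U = m := by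
  induction l generalizing m with
  | nil => simp at h
  | cons s l ih =>
    cases s
    · cases m with
      | zero => exact ⟨[], l, rfl, rfl⟩
      | succ m =>
        obtain ⟨A, B, rfl, rfl⟩ := ih (m := m) (by simpa using h)
        exact ⟨U :: A, B, rfl, by simp⟩
    · obtain ⟨A, B, rfl, rfl⟩ := ih (m := m) (by simpa using h)
      exact ⟨D :: A, B, rfl, by simp⟩

/-- A right rotation exists at every valley that is preceded by a down step. -/
theorem DyckPath.exists_rightRotation {n : ℕ} (P : DyckPath n) {m : ℕ} (hm : m + 1 < n)
    (hP : P.valley (m + 1) ≤ P.valley m) :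
    ∃ (P' : DyckPath n) (m' : ℕ), RightRotation P P' ∧ IsLift P.valley P'.valley (m + 1) m' := by
  obtain ⟨A, B, hAB, hA⟩ := exists_append_U_cons P.word.toList (m := m + 1) (by rwa [P.count_U])
  obtain ⟨V, rfl⟩ : ∃ V, A = V ++ [D] := by
    rcases A.eq_nil_or_concat with rfl | ⟨V, s, rfl⟩
    · simp at hA
    · cases s
      · exfalso
        simp only [List.concat_eq_append] at hA hAB
        have hV : V.count U = m := by simpa using hA
        have h1 := valley_append_add V (U :: U :: B) 0
        have h2 := valley_append_add V (U :: U :: B) 1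
        rw [DyckPath.valley, hAB] at hP
        simp only [List.append_assoc, List.cons_append, List.nil_append] at hP
        rw [hV] at h1 h2
        simp [TamariFormula.valley] at h1 h2
        omega
      · exact ⟨V, by simp⟩
  have hA' : V.count U = m + 1 := by simpa using hA
  obtain ⟨C, W, rfl⟩ := exists_dyckWord_append_of_height_neg B (by
    have h1 := height_dyckWord P.word
    have h2 := P.isDyckSeq.nonneg (m + 1)
    have h3 := valley_append_add (V ++ [D]) (U :: B) 0
    rw [hA] at h3
    rw [DyckPath.valley, hAB] at h2
    rw [hAB, height_append] at h1
    simp [TamariFormula.valley] at h1 h2 h3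
    omega)
  have hw : P.word.toList = V ++ [D] ++ C.nest.toList ++ W := by
    simp [hAB, DyckWord.nest]
  have hl := isLift_rotation V W (DyckWord.IsNested.nest (p := C))
  have hperm : (V ++ C.nest.toList ++ [D] ++ W).Perm P.word.toList := by
    rw [hw]
    refine List.Perm.append_right W ?_
    simp only [List.append_assoc]
    exact List.Perm.append_left V List.perm_append_comm
  rw [← hw, hA'] at hl
  let w : DyckWord := ⟨V ++ C.nest.toList ++ [D] ++ W, by
    rw [hperm.count_eq, hperm.count_eq, P.word.count_U_eq_count_D], fun i => by
      have h1 := valley_le_height_take (V ++ C.nest.toList ++ [D] ++ W) i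
      have h2 := hl.le_apply (((V ++ C.nest.toList ++ [D] ++ W).take i).count U)
      have h3 := P.isDyckSeq.nonneg (((V ++ C.nest.toList ++ [D] ++ W).take i).count U)
      rw [DyckPath.valley] at h3
      have h4 := (h3.trans h2).trans h1
      rw [height] at h4
      omega⟩
  exact ⟨⟨w, (hperm.count_eq U).trans P.count_U⟩, _, ⟨V, W, C.nest, .nest, hw, rfl⟩, hl⟩

/-! ### The longest chain -/

/-- The gap to the top of a chain drops at every step of the chain. -/
theorem length_le_gap {n : ℕ} (s : LTSeries (DyckPath n)) :
    (s.length : ℤ) ≤ gap n s.head.valley s.last.valley := by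
  have key (i : ℕ) (hi : i < s.length + 1) :
      (i : ℤ) + gap n (s ⟨i, hi⟩).valley s.last.valley ≤ gap n s.head.valley s.last.valley := by
    induction i with
    | zero => simp [RelSeries.head]
    | succ i ih =>
      have h1 := ih (by omega)
      have h2 : s ⟨i, by omega⟩ < s ⟨i + 1, hi⟩ := s.strictMono (by simp [Fin.lt_def])
      have h3 : s ⟨i + 1, hi⟩ ≤ s.last := LTSeries.monotone s (Fin.le_last _)
      have h4 := gap_lt (DyckPath.isDyckSeq _) (DyckPath.isDyckSeq _) (DyckPath.isDyckSeq _)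
        (below_of_le h2.le) (below_of_le h3) (DyckPath.valley_injective.ne h2.ne)
      push_cast
      omega
  have h := key s.length (by omega)
  have h2 : s ⟨s.length, by omega⟩ = s.last := rfl
  rw [h2, gap_self s.last.isDyckSeq] at h
  omega

/-- In particular `Below` is the Tamari order. -/
theorem exists_chain_of_gap_eq {n : ℕ} (Q : DyckPath n) (N : ℕ) (P : DyckPath n)
    (h : Below P.valley Q.valley) (hN : gap n P.valley Q.valley = N) :
    ∃ s : LTSeries (DyckPath n), s.head = P ∧ s.last = Q ∧ s.length = N := by
  induction N generalizing P with
  | zero =>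
    have : P = Q := by
      by_contra hne
      have := gap_lt P.isDyckSeq Q.isDyckSeq Q.isDyckSeq h (fun _ _ H => H)
        (DyckPath.valley_injective.ne hne)
      rw [gap_self Q.isDyckSeq, hN] at this
      simp at this
    exact ⟨RelSeries.singleton _ P, rfl, this, rfl⟩
  | succ N ih =>
    have hne : P.valley ≠ Q.valley := fun he => by
      rw [he, gap_self Q.isDyckSeq] at hN
      omega
    obtain ⟨p, m, hpm, hmn, heq, hvf, hvg, hmin⟩ :=
      exists_rotation_index P.isDyckSeq Q.isDyckSeq h hne
    obtain ⟨k, rfl⟩ : ∃ k, m = k + 1 := ⟨m - 1, by omega⟩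
    have hk : P.valley (k + 1) ≤ P.valley k := by
      rcases (show p = k ∨ p < k by omega) with rfl | hpk
      · exact heq.le
      · exact heq.trans_le (hvf k hpk (by omega)).le
    obtain ⟨P', m', hrot, hl⟩ := P.exists_rightRotation hmn hk
    have hgap := hl.gap_eq Q.isDyckSeq h hpm hmn heq hvf hvg hmin
    obtain ⟨s, h1, h2, h3⟩ := ih P' (hl.below_of_visible h hpm heq hvf hvg) (by omega)
    have hlt : P < P' := lt_of_le_of_ne (Relation.ReflTransGen.single hrot) fun he => by
      have := hrot.upDownPairs_lt
      rw [he] at this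
      omega
    refine ⟨s.cons P (h1 ▸ hlt), RelSeries.head_cons .., ?_, ?_⟩
    · rw [RelSeries.last_cons, h2]
    · rw [RelSeries.cons_length, h3]

theorem TamariInterval.distance_eq_gap {n : ℕ} (I : TamariInterval n) :
    (I.distance : ℤ) = gap n I.lower.valley I.upper.valley := by
  have hb := below_of_le I.le
  obtain ⟨N, hN⟩ := Int.eq_ofNat_of_zero_le (gap_nonneg I.lower.isDyckSeq I.upper.isDyckSeq hb)
  obtain ⟨h1, h2⟩ := I.isGreatest_distance
  refine le_antisymm ?_ ?_
  · obtain ⟨s, hs1, hs2, hs3⟩ := h1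
    rw [← hs1, ← hs2, ← hs3]
    exact length_le_gap s
  · rw [hN]
    exact_mod_cast h2 (exists_chain_of_gap_eq I.upper N I.lower hb hN)

/-! ### Contacts and descents in terms of the valley sequence -/

/-- `cᵢ(P)` is the number of indices with parent `i`. -/
theorem DyckPath.contactVector_eq {n : ℕ} (P : DyckPath n) (i : Fin (n + 1)) :
    P.contactVector i = ∑ k ∈ Finset.range n, if parent P.valley k = i then 1 else 0 := by
  classical
  obtain ⟨i, hi⟩ := i
  have hf := P.isDyckSeq
  have hc := count_U_afterUp P.word.toList (i := i) (by rw [P.count_U]; omega)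
  rw [P.count_U] at hc
  -- `t` is the height at which the word after the `i`-th up step starts
  obtain ⟨t, ht0, ht, hti⟩ : ∃ t : ℤ, 0 ≤ t ∧
      (∀ k, P.valley (i + k) = t + TamariFormula.valley (afterUp i P.word.toList) k) ∧
      (i ≠ 0 → P.valley (i - 1) = t - 1) := by
    cases i with
    | zero => exact ⟨0, le_rfl, fun k => by simp [afterUp, DyckPath.valley], by simp⟩
    | succ i =>
      have := hf.nonneg i
      exact ⟨P.valley i + 1, by omega, valley_succ_add _ (by rw [P.count_U]; omega), by simp⟩
  have hh : height (afterUp i P.word.toList) ≤ 0 := by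
    have h1 := ht (n - i)
    rw [hf.eq_zero _ (by omega), valley_of_count_le (by omega)] at h1
    omega
  have hz : (∑ k ∈ Finset.range i, if parent P.valley k = i then 1 else 0) = 0 := by
    refine Finset.sum_eq_zero fun k hk => if_neg ?_
    have := parent_le P.valley k
    rw [Finset.mem_range] at hk
    omega
  rw [contactVector, nonInitialContacts_eq hh, numContacts, ← Finset.sum_range_add_sum_Ico _
    (show i ≤ n by omega), hz, zero_add, Finset.sum_Ico_eq_sum_range,
    show (afterUp i P.word.toList).count U = n - i by omega]
  refine Finset.sum_congr rfl fun k _ => if_congr ?_ rfl rfl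
  simp only [parent_eq_iff]
  constructor
  · rintro ⟨h1, h2⟩
    refine ⟨by omega, fun h0 => ?_, fun j hj1 hj2 => ?_⟩
    · rw [hti h0, ht, h1]
      omega
    · obtain ⟨j, rfl⟩ := Nat.exists_eq_add_of_le hj1
      have := h2 j (by omega)
      rw [ht, ht, h1]
      omega
  · intro h
    have hk : TamariFormula.valley (afterUp i P.word.toList) k = 0 := by
      have h1 := apply_parent hf (i + k)
      rw [parent_eq_iff.2 h] at h1
      have h2 := ht 0
      have h3 := ht k
      have h4 := valley_zero_le (afterUp i P.word.toList)
      rw [add_zero] at h2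
      by_cases h0 : i = 0
      · have h5 := hf.zero
        have h6 := hf.nonneg k
        subst h0
        simp [DyckPath.valley, afterUp] at *
        omega
      · have h5 := h.2.1 h0
        rw [hti h0] at h5
        omega
    refine ⟨hk, fun j hj => ?_⟩
    have h1 := le_of_parent_le (f := P.valley) (k := i + k) (j := i + j)
      (by rw [parent_eq_iff.2 h]; omega) (by omega)
    rw [ht, ht, hk] at h1
    omega

theorem DyckPath.one_sub_descentVector_rev {n : ℕ} (Q : DyckPath n) {j : Fin (n + 1)}
    (hj : 0 < (j : ℕ)) :
    1 - (Q.descentVector j.rev : ℤ) = Q.valley j - Q.valley (j - 1) := by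
  have h1 := valley_succ_add Q.word.toList (i := j - 1) (by rw [Q.count_U]; omega) 0
  have h2 := valley_zero_eq_neg_length (afterUp j Q.word.toList)
  rw [show (j : ℕ) - 1 + 1 = j by omega] at h1
  have h3 : n - (j.rev : ℕ) = j := by rw [Fin.val_rev]; omega
  rw [descentVector, h3, DyckPath.valley]
  omega

theorem sum_ite_lt_sub (g : ℕ → ℤ) {i N : ℕ} (h : i ≤ N) :
    (∑ j ∈ Finset.range (N + 1), if i < j then g j - g (j - 1) else 0) = g N - g i := by
  induction N, h using Nat.le_induction with
  | base =>
    rw [sub_self]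
    refine Finset.sum_eq_zero fun j hj => if_neg ?_
    rw [Finset.mem_range] at hj
    omega
  | succ N h ih =>
    rw [Finset.sum_range_succ, ih, if_pos (by omega), Nat.add_sub_cancel]
    ring

/-- The sum over pairs of the contacts of `P` and the descents of `Q` telescopes to the gap. -/
theorem sum_contactVector_mul_descentVector {n : ℕ} (P Q : DyckPath n) :
    ∑ p : Fin (n + 1) × Fin (n + 1) with p.1 < p.2,
      ((P.contactVector p.1 : ℤ) - 1) * (1 - (Q.descentVector p.2.rev : ℤ)) =
      gap n P.valley Q.valley := by
  have hg := Q.isDyckSeq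
  have inner (i : Fin (n + 1)) :
      (∑ j : Fin (n + 1), if i < j then
        ((P.contactVector i : ℤ) - 1) * (1 - (Q.descentVector j.rev : ℤ)) else 0) =
      Q.valley i - P.contactVector i * Q.valley i := by
    have h1 := sum_ite_lt_sub Q.valley (show (i : ℕ) ≤ n by omega)
    rw [hg.eq_zero n le_rfl, ← Fin.sum_univ_eq_sum_range
      (fun j => if (i : ℕ) < j then Q.valley j - Q.valley (j - 1) else 0)] at h1
    calc _ = ∑ j : Fin (n + 1), ((P.contactVector i : ℤ) - 1) *
          if (i : ℕ) < j then Q.valley j - Q.valley (j - 1) else 0 := by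
          refine Finset.sum_congr rfl fun j _ => ?_
          by_cases hij : i < j
          · have hij' : (i : ℕ) < j := hij
            rw [if_pos hij, if_pos hij', Q.one_sub_descentVector_rev (by omega)]
          · have hij' : ¬(i : ℕ) < j := hij
            rw [if_neg hij, if_neg hij', mul_zero]
      _ = _ := by
          rw [← Finset.mul_sum, h1]
          ring
  rw [Finset.sum_filter, Fintype.sum_prod_type]
  simp only [inner, Finset.sum_sub_distrib, gap]
  congr 1
  · rw [Fin.sum_univ_eq_sum_range, Finset.sum_range_succ, hg.eq_zero n le_rfl, add_zero]
  · simp only [P.contactVector_eq]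
    push_cast
    simp only [Finset.sum_mul]
    rw [Finset.sum_comm]
    refine Finset.sum_congr rfl fun k hk => ?_
    have hk' := parent_le P.valley k
    rw [Finset.mem_range] at hk
    rw [Finset.sum_eq_single (⟨parent P.valley k, by omega⟩ : Fin (n + 1))]
    · simp
    · intro j _ hj
      rw [if_neg, zero_mul]
      exact fun h => hj (Fin.ext h.symm)
    · simp

end TamariFormula

theorem mainTheorem2 (n : ℕ) (I : TamariFormula.TamariInterval n) :
    (I.distance : ℤ) =
      ∑ p : Fin (n + 1) × Fin (n + 1) with p.1 < p.2,
        ((I.contactVector p.1 : ℤ) - 1) * (1 - (I.descentVector (Fin.rev p.2) : ℤ)) := by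
  rw [I.distance_eq_gap]
  exact (TamariFormula.sum_contactVector_mul_descentVector I.lower I.upper).symm
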